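/- **Lemma 1 (RE conditions for $\hat\Gamma_{\mathrm{REN}}$).** There are absolute constants $C,c>0$ such that the following holds. Let $n,p,k\ge 1$ and $n_o\ge 0$ be integers with $n\le p$ and $k<p$, let $\Sigma_x\in\mathbb{R}^{p\times p}$ be symmetric positive definite, let $\sigma_x>0$ and $\alpha\in[0,1]$, and suppose $$n\ \ge\ C\,\frac{\sigma_x^4}{\lambda_{\min}(\Sigma_x)^2}\,k\log p ,\qquad \frac{n_o}{n}\ \le\ c\,\frac{\lambda_{\min}(\Sigma_x)}{\sigma_x^2\,k\log p}.$$ Let $X$ be a random $n\times p$ matrix (the authentic data) that is sub-Gaussian with parameter $(\frac1n\Sigma_x,\frac1n\sigma_x^2)$: its rows $x_1^T,\dots,x_n^T$ are independent, each $x_i$ has mean zero and covariance $\frac1n\Sigma_x$, and $\mathbb{E}\exp(t\,u^Tx_i)\le\exp\!\big(\frac{t^2\sigma_x^2}{2n}\big)$ for all $t\in\mathbb{R}$ and all unit vectors $u\in\mathbb{R}^p$. The observed matrix $Z\in\mathbb{R}^{(n+n_o)\times p}$ consists of the $n$ rows of $X$, at arbitrary positions, and of $n_o$ arbitrary further rows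 (which may depend on $X$). For $u,v\in\mathbb{R}^{n+n_o}$ let the trimmed inner product $\langle u,v\rangle_{n_o}$ be the sum of $u_kv_k$ over the $n$ indices $k$ with the smallest values $|u_kv_k|$ (that is, the $n_o$ products largest in absolute value are discarded; ties are broken by the index), and define, with $Z_i$ the $i$th column of $Z$, $$\{\hat\Gamma_{\mathrm{REN}}\}_{ij}=\alpha\,\langle Z_i,Z_j\rangle_{n_o}+(1-\alpha)\,I_{ij}.$$ Then $\mu_1=\alpha\frac{\lambda_{\min}(\Sigma_x)}{2}+(1-\alpha)$ and $\mu_2=\alpha\frac{3\lambda_{\max}(\Sigma_x)}{2}+(1-\alpha)$ are positive, and there is a deterministic $\tau\ge 0$ with $\tau\le\frac{\alpha}{8}\lambda_{\min}(\Sigma_x)$, and $\tau>0$ if $\alpha>0$, such that, with probability higher than $1-p^{-2}$, for all such observed matrices $Z$ simultaneously, $\hat\Gamma_{\mathrm{REN}}$ satisfies the lower-RE condition with curvature $\mu_1$ and tolerance $\tau$ and the upper-RE condition with curvature $\mu_2$ and tolerance $\tau$, i.e. for all $\theta\in\mathbb{R}^p$ $$\theta^T\hat\Gamma_{\mathrm{REN}}\,\theta\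 \ge\ \mu_1\|\theta\|_2^2-\tau\|\theta\|_1^2,\qquad \theta^T\hat\Gamma_{\mathrm{REN}}\,\theta\ \le\ \mu_2\|\theta\|_2^2+\tau\|\theta\|_1^2 .$$ -/

import Mathlib

open MeasureTheory ProbabilityTheory
open scoped NNReal Matrix

/-- A random `n × p` matrix is sub-Gaussian with parameter `(A, v)`: its rows are independent,
each row has mean zero and covariance matrix `A`, and the projection of each row on every unit
vector `u` satisfies `E exp (t uᵀx) ≤ exp (v t² / 2)` for all real `t`
(that is, it is sub-Gaussian with parameter at most `√v`). -/
structure IsSubGaussianMatrix {Ω : Type*} [MeasurableSpace Ω] (P : Measure Ω) {n p : ℕ}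
    (X : Ω → Matrix (Fin n) (Fin p) ℝ) (A : Matrix (Fin p) (Fin p) ℝ) (v : ℝ≥0) : Prop where
  measurable_row : ∀ i : Fin n, Measurable (fun ω => X ω i)
  indep_row : iIndepFun (fun (i : Fin n) (ω : Ω) => X ω i) P
  mean_zero : ∀ (i : Fin n) (a : Fin p), ∫ ω, X ω i a ∂P = 0
  covariance_eq : ∀ (i : Fin n) (a b : Fin p),
    covariance (fun ω => X ω i a) (fun ω => X ω i b) P = A a b
  subgaussian : ∀ (i : Fin n) (u : EuclideanSpace ℝ (Fin p)), ‖u‖ = 1 →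
    HasSubgaussianMGF (fun ω => ∑ a, u a * X ω i a) v P

/-- `Z` is an observed data matrix with `n + no` rows: `n` of its rows, at arbitrary positions, are
the authentic rows (the rows of `X`), and the other `no` rows are arbitrary. -/
def IsCorruption {n p : ℕ} (no : ℕ) (X : Matrix (Fin n) (Fin p) ℝ)
    (Z : Matrix (Fin (n + no)) (Fin p) ℝ) : Prop :=
  ∃ e : Fin n ↪ Fin (n + no), ∀ i : Fin n, Z (e i) = X i

/-- The trimmed inner product of `u` and `v` in `ℝ^N`: order the indices so that `|u k * v k|`
increases, discard the `no` last ones, and sum the products `u k * v k` over those kept. -/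
noncomputable def trimmedInner {N : ℕ} (no : ℕ) (u v : Fin N → ℝ) : ℝ :=
  ∑ k : Fin N with k.val + no < N,
    u (Tuple.sort (fun l => |u l * v l|) k) * v (Tuple.sort (fun l => |u l * v l|) k)

/-- The robust elastic net matrix: the entries of `Zᵀ Z` are replaced by trimmed inner products
of the columns of `Z`, and the result is shrunk towards the identity. -/
noncomputable def renGamma {N p : ℕ} (α : ℝ) (no : ℕ) (Z : Matrix (Fin N) (Fin p) ℝ) :
    Matrix (Fin p) (Fin p) ℝ :=
  Matrix.of fun i j => α * trimmedInner no (fun k => Z k i) (fun k => Z k j) +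
    (1 - α) * (1 : Matrix (Fin p) (Fin p) ℝ) i j

/-- Lower restricted eigenvalue condition with curvature `μ` and tolerance `τ`. -/
def LowerRE {p : ℕ} (G : Matrix (Fin p) (Fin p) ℝ) (μ τ : ℝ) : Prop :=
  0 < μ ∧ 0 ≤ τ ∧ ∀ θ : Fin p → ℝ,
    θ ⬝ᵥ (G *ᵥ θ) ≥ μ * ‖WithLp.toLp 2 θ‖ ^ 2 - τ * ‖WithLp.toLp 1 θ‖ ^ 2

/-- Upper restricted eigenvalue condition with curvature `μ` and tolerance `τ`. -/
def UpperRE {p : ℕ} (G : Matrix (Fin p) (Fin p) ℝ) (μ τ : ℝ) : Prop :=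
  0 < μ ∧ 0 ≤ τ ∧ ∀ θ : Fin p → ℝ,
    θ ⬝ᵥ (G *ᵥ θ) ≤ μ * ‖WithLp.toLp 2 θ‖ ^ 2 + τ * ‖WithLp.toLp 1 θ‖ ^ 2

/-- Smallest eigenvalue of a real symmetric matrix. -/
noncomputable def lambdaMin {p : ℕ} {A : Matrix (Fin p) (Fin p) ℝ} (hA : A.IsHermitian) : ℝ :=
  ⨅ i, hA.eigenvalues i

/-- Largest eigenvalue of a real symmetric matrix. -/
noncomputable def lambdaMax {p : ℕ} {A : Matrix (Fin p) (Fin p) ℝ} (hA : A.IsHermitian) : ℝ :=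
  ⨆ i, hA.eigenvalues i

/-! Write the trimmed Gram matrix as `Sx + D`. If every entry of `D` is at most `λ_min / 8` in
absolute value, then `|θᵀDθ| ≤ (λ_min / 8) ‖θ‖₁²`, and the spectral bounds on `θᵀ Sx θ` give both RE
conditions with `τ = α λ_min / 8` (`lowerRE_and_upperRE_renGamma`).

The entrywise bound has two halves, each costing `λ_min / 16`. Trimming against the authentic Gram
matrix is deterministic: the kept and the authentic index sets differ by at most `no` indices on
each side, and no product involved exceeds the largest authentic one (`abs_trimmedInner_sub_le`).
The authentic Gram matrix concentrates around `Sx` because products of sub-Gaussian variables are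
sub-exponential (`measureReal_abs_sum_mul_sub_integral_ge_le`). The good event concerns `X` alone,
whence uniformity over all corruptions `Z`. -/

/-! ### Trimming as a deterministic perturbation. -/

/-- The trimmed inner product differs from the sum over any `n` rows by at most `2 * no` times
the largest product on those rows. -/
theorem abs_trimmedInner_sub_le {n no : ℕ} (u v : Fin (n + no) → ℝ) (e : Fin n ↪ Fin (n + no))
    {M : ℝ} (hM : 0 ≤ M) (h : ∀ i, |u (e i) * v (e i)| ≤ M) :
    |trimmedInner no u v - ∑ i, u (e i) * v (e i)| ≤ 2 * no * M := by
  classical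
  set w : Fin (n + no) → ℝ := fun l => u l * v l with hw
  set s := Tuple.sort (fun l => |u l * v l|) with hs
  have hmono : Monotone ((fun l => |w l|) ∘ s) := Tuple.monotone_sort _
  set F : Finset (Fin (n + no)) := Finset.univ.filter fun k => k.val + no < n + no with hF
  set K : Finset (Fin (n + no)) := F.map s.toEmbedding with hK
  set A : Finset (Fin (n + no)) := Finset.univ.map e with hA
  have hT : trimmedInner no u v = ∑ l ∈ K, w l := by
    rw [hK, Finset.sum_map]; rfl
  have hS : ∑ i, u (e i) * v (e i) = ∑ l ∈ A, w l := by
    rw [hA, Finset.sum_map]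
  have hAc : A.card = n := by simp [hA]
  have hFc : F.card = n := by
    have : F = Finset.univ.map (Fin.castAddEmb no) := by
      ext k
      simp only [hF, Finset.mem_filter, Finset.mem_univ, true_and, Finset.mem_map]
      constructor
      · intro hk
        exact ⟨⟨k.val, by omega⟩, by ext; simp⟩
      · rintro ⟨a, rfl⟩
        simp
    rw [this]; simp
  have hKc : K.card = n := by rw [hK, Finset.card_map, hFc]
  have hAK : ∀ l ∈ A \ K, |w l| ≤ M := by
    intro l hl
    obtain ⟨i, -, rfl⟩ := Finset.mem_map.1 (Finset.mem_sdiff.1 hl).1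
    exact h i
  have hcard : (K \ A).card = (A \ K).card := by
    have h1 := Finset.card_sdiff_add_card K A
    have h2 := Finset.card_sdiff_add_card A K
    rw [Finset.union_comm] at h2
    omega
  have hKno : (K \ A).card ≤ no := by
    have h1 := Finset.card_sdiff_add_card K A
    have h2 := Finset.card_le_univ (K ∪ A)
    simp only [Fintype.card_fin] at h2
    omega
  -- If a corrupted index is kept, equal cardinalities force some authentic index `m` to be
  -- discarded. The sorting then bounds the corrupted product by the one at `m`.
  have hKA : ∀ l ∈ K \ A, |w l| ≤ M := by
    intro l hl
    have hne : (A \ K).Nonempty := by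
      rw [← Finset.card_pos, ← hcard]; exact Finset.card_pos.2 ⟨l, hl⟩
    obtain ⟨m, hm⟩ := hne
    obtain ⟨a, ha, rfl⟩ := Finset.mem_map.1 (Finset.mem_sdiff.1 hl).1
    have hmK : s.symm m ∉ F := by
      intro hmF
      exact (Finset.mem_sdiff.1 hm).2 (Finset.mem_map.2 ⟨_, hmF, by simp⟩)
    have hle : a ≤ s.symm m := by
      simp only [hF, Finset.mem_filter, Finset.mem_univ, true_and, not_lt] at ha hmK
      rw [Fin.le_def]; omega
    have := hmono hle
    simp only [Function.comp_apply, Equiv.apply_symm_apply] at this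
    exact this.trans (hAK m hm)
  have hbound : ∀ B : Finset (Fin (n + no)), B.card ≤ no → (∀ l ∈ B, |w l| ≤ M) →
      |∑ l ∈ B, w l| ≤ no * M := by
    intro B hB hBM
    calc |∑ l ∈ B, w l| ≤ ∑ l ∈ B, |w l| := Finset.abs_sum_le_sum_abs _ _
      _ ≤ B.card • M := Finset.sum_le_card_nsmul _ _ _ hBM
      _ = B.card * M := by simp
      _ ≤ no * M := by gcongr
  have h1 := hbound _ hKno hKA
  have h2 := hbound _ (hcard ▸ hKno) hAK
  have h3 : ∑ l ∈ K, w l - ∑ l ∈ A, w l = ∑ l ∈ K \ A, w l - ∑ l ∈ A \ K, w l :=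
    (Finset.sum_sdiff_sub_sum_sdiff).symm
  rw [hT, hS, h3]
  have := abs_sub (∑ l ∈ K \ A, w l) (∑ l ∈ A \ K, w l)
  linarith

/-! ### Quadratic forms: spectral and entrywise bounds. -/

theorem dotProduct_mulVec_eq_sum_eigenvalues {p : ℕ} {A : Matrix (Fin p) (Fin p) ℝ}
    (hA : A.IsHermitian) (x : Fin p → ℝ) :
    x ⬝ᵥ (A *ᵥ x) =
      ∑ i, hA.eigenvalues i * inner ℝ (hA.eigenvectorBasis i) (WithLp.toLp 2 x) ^ 2 := by
  have h1 : x ⬝ᵥ (A *ᵥ x) = inner ℝ (WithLp.toLp 2 x) (WithLp.toLp 2 (A *ᵥ x)) := by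
    rw [EuclideanSpace.inner_toLp_toLp, dotProduct_comm]; simp
  rw [h1, ← hA.eigenvectorBasis.sum_inner_mul_inner]
  refine Finset.sum_congr rfl fun i _ => ?_
  have h2 : inner ℝ (hA.eigenvectorBasis i) (WithLp.toLp 2 (A *ᵥ x)) =
      hA.eigenvalues i * inner ℝ (hA.eigenvectorBasis i) (WithLp.toLp 2 x) := by
    have h3 : ∀ y : Fin p → ℝ, inner ℝ (hA.eigenvectorBasis i) (WithLp.toLp 2 y) =
        y ⬝ᵥ (hA.eigenvectorBasis i).ofLp := fun y => by
      simp [EuclideanSpace.inner_eq_star_dotProduct]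
    have hT : Aᵀ = A := by simpa [Matrix.IsHermitian] using hA
    rw [h3, h3, dotProduct_comm, Matrix.dotProduct_mulVec, ← Matrix.mulVec_transpose, hT,
      hA.mulVec_eigenvectorBasis, smul_dotProduct, dotProduct_comm, smul_eq_mul]
  rw [h2, real_inner_comm]; ring

theorem lambdaMin_mul_norm_sq_le {p : ℕ} {A : Matrix (Fin p) (Fin p) ℝ} (hA : A.IsHermitian)
    (x : Fin p → ℝ) : lambdaMin hA * ‖WithLp.toLp 2 x‖ ^ 2 ≤ x ⬝ᵥ (A *ᵥ x) := by
  rw [dotProduct_mulVec_eq_sum_eigenvalues hA, ← hA.eigenvectorBasis.sum_sq_inner_right,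
    Finset.mul_sum]
  gcongr with i
  exact ciInf_le (Set.finite_range _).bddBelow i

theorem le_lambdaMax_mul_norm_sq {p : ℕ} {A : Matrix (Fin p) (Fin p) ℝ} (hA : A.IsHermitian)
    (x : Fin p → ℝ) : x ⬝ᵥ (A *ᵥ x) ≤ lambdaMax hA * ‖WithLp.toLp 2 x‖ ^ 2 := by
  rw [dotProduct_mulVec_eq_sum_eigenvalues hA, ← hA.eigenvectorBasis.sum_sq_inner_right,
    Finset.mul_sum]
  gcongr with i
  exact le_ciSup (Set.finite_range _).bddAbove i

theorem lambdaMin_pos {p : ℕ} [NeZero p] {A : Matrix (Fin p) (Fin p) ℝ} (hA : A.PosDef) :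
    0 < lambdaMin hA.isHermitian := by
  obtain ⟨i, hi⟩ := exists_eq_ciInf_of_finite (f := hA.isHermitian.eigenvalues)
  rw [lambdaMin, ← hi]
  exact hA.eigenvalues_pos i

theorem lambdaMin_le_lambdaMax {p : ℕ} [NeZero p] {A : Matrix (Fin p) (Fin p) ℝ}
    (hA : A.IsHermitian) : lambdaMin hA ≤ lambdaMax hA :=
  (ciInf_le (Set.finite_range _).bddBelow 0).trans (le_ciSup (Set.finite_range _).bddAbove 0)

theorem lambdaMin_le_diag {p : ℕ} {A : Matrix (Fin p) (Fin p) ℝ} (hA : A.IsHermitian)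
    (a : Fin p) : lambdaMin hA ≤ A a a := by
  have h := lambdaMin_mul_norm_sq_le hA (Pi.single a 1)
  simpa using h

theorem abs_dotProduct_mulVec_le {p : ℕ} (D : Matrix (Fin p) (Fin p) ℝ) {M : ℝ}
    (hD : ∀ i j, |D i j| ≤ M) (x : Fin p → ℝ) :
    |x ⬝ᵥ (D *ᵥ x)| ≤ M * ‖WithLp.toLp 1 x‖ ^ 2 := by
  have hn : ‖WithLp.toLp 1 x‖ = ∑ i, |x i| := by simp [PiLp.norm_eq_of_nat 1]
  rw [hn, sq, Finset.sum_mul_sum, Finset.mul_sum]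
  simp only [dotProduct, Matrix.mulVec, Finset.mul_sum]
  refine (Finset.abs_sum_le_sum_abs _ _).trans (Finset.sum_le_sum fun i _ => ?_)
  refine (Finset.abs_sum_le_sum_abs _ _).trans (Finset.sum_le_sum fun j _ => ?_)
  rw [abs_mul, abs_mul]
  have h := mul_le_mul_of_nonneg_right (hD i j) (mul_nonneg (abs_nonneg (x i)) (abs_nonneg (x j)))
  linarith

/-! ### Exponential moments and concentration of products of sub-Gaussian variables. -/

section SubGaussianProducts

variable {Ω : Type*} [MeasurableSpace Ω] {P : Measure Ω}

/-- Completing the square writes `exp (y² / (4v))` as a Gaussian average of `exp (g y)`. After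
Tonelli the MGF bound costs `exp (v g² / 2)`, which halves the Gaussian rate `v` and so gives the
factor `√2 ≤ 3/2`. Lower integrals make the bound yield integrability as well. -/
theorem lintegral_exp_sq_le_of_hasSubgaussianMGF [SFinite P] {a : Ω → ℝ} {v : ℝ≥0} (hv : 0 < v)
    (ha : Measurable a) (h : HasSubgaussianMGF a v P) :
    ∫⁻ ω, ENNReal.ofReal (Real.exp (a ω ^ 2 / (4 * v))) ∂P ≤ ENNReal.ofReal (3 / 2) := by
  have hv' : (0 : ℝ) < v := hv
  set G : ℝ := √(Real.pi / v) with hG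
  have hGpos : 0 < G := Real.sqrt_pos.2 (by positivity)
  have gauss : ∀ b : ℝ, 0 < b →
      ∫⁻ g : ℝ, ENNReal.ofReal (Real.exp (-b * g ^ 2)) = ENNReal.ofReal (√(Real.pi / b)) := by
    intro b hb
    rw [← integral_gaussian, ofReal_integral_eq_lintegral_ofReal (integrable_exp_neg_mul_sq hb)
      (Filter.Eventually.of_forall fun _ => (Real.exp_pos _).le)]
  have shift : ∀ y : ℝ, ENNReal.ofReal G * ENNReal.ofReal (Real.exp (y ^ 2 / (4 * v))) =
      ∫⁻ g : ℝ, ENNReal.ofReal (Real.exp (-v * g ^ 2) * Real.exp (g * y)) := by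
    intro y
    rw [hG, ← gauss v hv', ← lintegral_sub_right_eq_self
      (fun g : ℝ => ENNReal.ofReal (Real.exp (-v * g ^ 2))) (y / (2 * v)),
      ← lintegral_mul_const _ (by fun_prop)]
    refine lintegral_congr fun g => ?_
    rw [← ENNReal.ofReal_mul (Real.exp_pos _).le, ← Real.exp_add, ← Real.exp_add]
    congr 2
    field_simp
    ring
  have key : ENNReal.ofReal G * ∫⁻ ω, ENNReal.ofReal (Real.exp (a ω ^ 2 / (4 * v))) ∂P ≤
      ENNReal.ofReal G * ENNReal.ofReal (3 / 2) := by
    calc _ = ∫⁻ ω, (∫⁻ g : ℝ, ENNReal.ofReal (Real.exp (-v * g ^ 2) * Real.exp (g * a ω))) ∂P := by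
          rw [← lintegral_const_mul _ (by fun_prop)]
          exact lintegral_congr fun ω => shift _
      _ = ∫⁻ g : ℝ, ∫⁻ ω, ENNReal.ofReal (Real.exp (-v * g ^ 2) * Real.exp (g * a ω)) ∂P :=
          lintegral_lintegral_swap (by fun_prop)
      _ ≤ ∫⁻ g : ℝ, ENNReal.ofReal (Real.exp (-(v / 2 : ℝ) * g ^ 2)) := by
          refine lintegral_mono fun g => ?_
          rw [← ofReal_integral_eq_lintegral_ofReal ((h.integrable_exp_mul g).const_mul _)
            (Filter.Eventually.of_forall fun _ => by positivity), integral_const_mul]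
          refine ENNReal.ofReal_le_ofReal ?_
          calc _ ≤ Real.exp (-v * g ^ 2) * Real.exp (v * g ^ 2 / 2) := by
                gcongr; exact h.mgf_le g
            _ = _ := by rw [← Real.exp_add]; congr 1; ring
      _ = ENNReal.ofReal (√(Real.pi / (v / 2 : ℝ))) := gauss _ (by positivity)
      _ ≤ _ := by
          rw [← ENNReal.ofReal_mul hGpos.le]
          refine ENNReal.ofReal_le_ofReal (Real.sqrt_le_iff.2 ⟨by positivity, ?_⟩)
          rw [mul_pow, hG, Real.sq_sqrt (by positivity)]
          have : (0 : ℝ) < Real.pi / v := by positivity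
          rw [show Real.pi / (v / 2 : ℝ) = Real.pi / v * 2 by field_simp]
          nlinarith
  exact (ENNReal.mul_le_mul_iff_right (by simpa using hGpos) ENNReal.ofReal_ne_top).1 key

theorem integrable_exp_sq_of_hasSubgaussianMGF [SFinite P] {a : Ω → ℝ} {v : ℝ≥0} (hv : 0 < v)
    (ha : Measurable a) (h : HasSubgaussianMGF a v P) :
    Integrable (fun ω => Real.exp (a ω ^ 2 / (4 * v))) P := by
  refine ⟨by fun_prop, ?_⟩
  rw [hasFiniteIntegral_iff_ofReal (Filter.Eventually.of_forall fun _ => (Real.exp_pos _).le)]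
  exact (lintegral_exp_sq_le_of_hasSubgaussianMGF hv ha h).trans_lt ENNReal.ofReal_lt_top

theorem integral_exp_sq_le_of_hasSubgaussianMGF [SFinite P] {a : Ω → ℝ} {v : ℝ≥0} (hv : 0 < v)
    (ha : Measurable a) (h : HasSubgaussianMGF a v P) :
    ∫ ω, Real.exp (a ω ^ 2 / (4 * v)) ∂P ≤ 3 / 2 := by
  refine (ENNReal.ofReal_le_ofReal_iff (by norm_num)).1 ?_
  rw [ofReal_integral_eq_lintegral_ofReal (integrable_exp_sq_of_hasSubgaussianMGF hv ha h)
    (Filter.Eventually.of_forall fun _ => (Real.exp_pos _).le)]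
  exact lintegral_exp_sq_le_of_hasSubgaussianMGF hv ha h

/-- Follows from `x + 1 ≤ exp x`. It serves to compare `λ_min` with `σ²`. -/
theorem integral_sq_le_of_hasSubgaussianMGF [IsProbabilityMeasure P] {a : Ω → ℝ} {v : ℝ≥0}
    (hv : 0 < v) (ha : Measurable a) (h : HasSubgaussianMGF a v P) :
    ∫ ω, a ω ^ 2 ∂P ≤ 2 * v := by
  have hv' : (0 : ℝ) < v := hv
  have hint : Integrable (fun ω => a ω ^ 2) P := by simpa using (h.memLp 2).integrable_sq
  have h1 : ∫ ω, (a ω ^ 2 / (4 * v) + 1) ∂P ≤ ∫ ω, Real.exp (a ω ^ 2 / (4 * v)) ∂P :=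
    integral_mono ((hint.div_const _).add (integrable_const _))
      (integrable_exp_sq_of_hasSubgaussianMGF hv ha h) fun ω => Real.add_one_le_exp _
  rw [integral_add (hint.div_const _) (integrable_const _), integral_div] at h1
  have h2 := h1.trans (integral_exp_sq_le_of_hasSubgaussianMGF hv ha h)
  have h3 : (∫ ω, a ω ^ 2 ∂P) / (4 * v) ≤ 1 / 2 := by
    simp at h2; linarith
  rw [div_le_iff₀ (by positivity)] at h3
  linarith

/-- The arithmetic-geometric mean inequality, in the exponent and then for the exponentials. It
decouples the two factors without independence. -/
theorem exp_abs_mul_div_le {v : ℝ} (hv : 0 < v) (x y : ℝ) :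
    Real.exp (|x * y| / (4 * v)) ≤
      (Real.exp (x ^ 2 / (4 * v)) + Real.exp (y ^ 2 / (4 * v))) / 2 := by
  have h1 : |x * y| ≤ (x ^ 2 + y ^ 2) / 2 := by
    rw [abs_le]; constructor <;> nlinarith [sq_nonneg (x + y), sq_nonneg (x - y)]
  have h2 : Real.exp (|x * y| / (4 * v)) ≤
      Real.exp (x ^ 2 / (4 * v) / 2) * Real.exp (y ^ 2 / (4 * v) / 2) := by
    rw [← Real.exp_add, Real.exp_le_exp, ← add_div, ← add_div, div_right_comm]
    gcongr
  have h3 : ∀ z : ℝ, Real.exp z = Real.exp (z / 2) ^ 2 := fun z => by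
    rw [← Real.exp_nat_mul]; congr 1; push_cast; ring
  rw [h3 (x ^ 2 / (4 * v)), h3 (y ^ 2 / (4 * v))]
  nlinarith [sq_nonneg (Real.exp (x ^ 2 / (4 * v) / 2) - Real.exp (y ^ 2 / (4 * v) / 2))]

theorem integrable_exp_abs_mul_div [SFinite P] {a b : Ω → ℝ} {v : ℝ≥0}
    (hv : 0 < v) (ha : Measurable a) (hb : Measurable b) (hsa : HasSubgaussianMGF a v P)
    (hsb : HasSubgaussianMGF b v P) :
    Integrable (fun ω => Real.exp (|a ω * b ω| / (4 * v))) P := by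
  refine (((integrable_exp_sq_of_hasSubgaussianMGF hv ha hsa).add
    (integrable_exp_sq_of_hasSubgaussianMGF hv hb hsb)).div_const 2).mono' (by fun_prop) ?_
  refine Filter.Eventually.of_forall fun ω => ?_
  rw [Real.norm_of_nonneg (Real.exp_pos _).le]
  exact exp_abs_mul_div_le hv _ _

theorem integral_exp_abs_mul_div_le [SFinite P] {a b : Ω → ℝ} {v : ℝ≥0}
    (hv : 0 < v) (ha : Measurable a) (hb : Measurable b) (hsa : HasSubgaussianMGF a v P)
    (hsb : HasSubgaussianMGF b v P) :
    ∫ ω, Real.exp (|a ω * b ω| / (4 * v)) ∂P ≤ 3 / 2 := by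
  have hia := integrable_exp_sq_of_hasSubgaussianMGF hv ha hsa
  have hib := integrable_exp_sq_of_hasSubgaussianMGF hv hb hsb
  have h1 := integral_mono (integrable_exp_abs_mul_div hv ha hb hsa hsb)
    ((hia.add hib).div_const 2) fun ω => exp_abs_mul_div_le hv (a ω) (b ω)
  refine h1.trans ?_
  simp only [Pi.add_apply]
  rw [integral_div, integral_add hia hib]
  have := integral_exp_sq_le_of_hasSubgaussianMGF hv ha hsa
  have := integral_exp_sq_le_of_hasSubgaussianMGF hv hb hsb
  linarith

/-- Second-order Taylor bound with remainder `z² exp |z|`. The exponential budget `|w| / (4v)` is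
split in two halves `y`: one dominates `exp |s w|`, the other absorbs `w² = 64 v² y²` through `y² ≤
2 exp y`, whence `128`. -/
theorem exp_mul_le_quadratic {v s w : ℝ} (hv : 0 < v) (hs : |s| ≤ 1 / (8 * v)) :
    Real.exp (s * w) ≤ 1 + s * w + 128 * v ^ 2 * s ^ 2 * Real.exp (|w| / (4 * v)) := by
  have h1 : Real.exp (s * w) ≤ 1 + s * w + (s * w) ^ 2 * Real.exp |s * w| := by
    have h := Complex.norm_exp_sub_sum_le_norm_mul_exp ((s * w : ℝ) : ℂ) 2
    have hcast : Complex.exp ((s * w : ℝ) : ℂ) -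
        ∑ m ∈ Finset.range 2, ((s * w : ℝ) : ℂ) ^ m / m.factorial =
        ((Real.exp (s * w) - (1 + s * w) : ℝ) : ℂ) := by
      simp [Finset.sum_range_succ]
    rw [hcast, Complex.norm_real, Complex.norm_real, Real.norm_eq_abs, Real.norm_eq_abs,
      sq_abs] at h
    linarith [(abs_le.1 h).2]
  set y : ℝ := |w| / (8 * v) with hy
  have hy0 : 0 ≤ y := by positivity
  have h2 : |s * w| ≤ y := by
    rw [abs_mul, hy, div_eq_mul_one_div |w|, mul_comm |w|]
    gcongr
  have h3 : w ^ 2 = 64 * v ^ 2 * y ^ 2 := by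
    rw [hy, div_pow, sq_abs]; field_simp; ring
  have h4 : y ^ 2 ≤ 2 * Real.exp y := by
    have := Real.quadratic_le_exp_of_nonneg hy0
    linarith
  have h5 : Real.exp (|w| / (4 * v)) = Real.exp y * Real.exp y := by
    rw [← Real.exp_add]; congr 1; rw [hy]; field_simp; ring
  have h6 : (s * w) ^ 2 * Real.exp |s * w| ≤
      (s ^ 2 * (64 * v ^ 2 * (2 * Real.exp y))) * Real.exp y := by
    rw [mul_pow, h3]; gcongr
  rw [h5]
  linarith

theorem integrable_exp_mul_mul [SFinite P] {a b : Ω → ℝ} {v : ℝ≥0}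
    (hv : 0 < v) (ha : Measurable a) (hb : Measurable b) (hsa : HasSubgaussianMGF a v P)
    (hsb : HasSubgaussianMGF b v P) {s : ℝ} (hs : |s| ≤ 1 / (8 * v)) :
    Integrable (fun ω => Real.exp (s * (a ω * b ω))) P := by
  have hv' : (0 : ℝ) < v := hv
  refine (integrable_exp_abs_mul_div hv ha hb hsa hsb).mono' (by fun_prop) ?_
  refine Filter.Eventually.of_forall fun ω => ?_
  rw [Real.norm_of_nonneg (Real.exp_pos _).le, Real.exp_le_exp]
  calc s * (a ω * b ω) ≤ |s| * |a ω * b ω| := by rw [← abs_mul]; exact le_abs_self _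
    _ ≤ 1 / (4 * v) * |a ω * b ω| := by
        gcongr
        refine hs.trans ?_
        gcongr
        norm_num
    _ = _ := by ring

/-- The centred product of two sub-Gaussian variables is sub-exponential. -/
theorem mgf_mul_sub_integral_le [IsProbabilityMeasure P] {a b : Ω → ℝ} {v : ℝ≥0}
    (hv : 0 < v) (ha : Measurable a) (hb : Measurable b) (hsa : HasSubgaussianMGF a v P)
    (hsb : HasSubgaussianMGF b v P) {s : ℝ} (hs : |s| ≤ 1 / (8 * v)) :
    mgf (fun ω => a ω * b ω - ∫ ω, a ω * b ω ∂P) P s ≤ Real.exp (192 * v ^ 2 * s ^ 2) := by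
  have hv' : (0 : ℝ) < v := hv
  set m := ∫ ω, a ω * b ω ∂P with hm
  have hab : Integrable (fun ω => a ω * b ω) P :=
    (by simpa using hsa.memLp 2 : MemLp a 2 P).integrable_mul (by simpa using hsb.memLp 2)
  have hE := integrable_exp_abs_mul_div hv ha hb hsa hsb
  -- Here `192 = 128 * (3 / 2)`; the linear term is cancelled below by the centring.
  have h1 : ∫ ω, Real.exp (s * (a ω * b ω)) ∂P ≤ 1 + s * m + 192 * v ^ 2 * s ^ 2 := by
    have hlin : Integrable (fun ω => 1 + s * (a ω * b ω)) P :=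
      (integrable_const _).add (hab.const_mul s)
    refine (integral_mono (integrable_exp_mul_mul hv ha hb hsa hsb hs)
      (hlin.add (hE.const_mul (128 * v ^ 2 * s ^ 2)))
      fun ω => exp_mul_le_quadratic hv' hs).trans ?_
    simp only [Pi.add_apply]
    rw [integral_add hlin (hE.const_mul _), integral_add (integrable_const _) (hab.const_mul s),
      integral_const_mul, integral_const_mul]
    have h2 := mul_le_mul_of_nonneg_left (integral_exp_abs_mul_div_le hv ha hb hsa hsb)
      (show (0 : ℝ) ≤ 128 * v ^ 2 * s ^ 2 by positivity)
    simp only [integral_const, probReal_univ, smul_eq_mul, mul_one]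
    linarith
  have h3 : mgf (fun ω => a ω * b ω - m) P s =
      Real.exp (-(s * m)) * ∫ ω, Real.exp (s * (a ω * b ω)) ∂P := by
    rw [mgf, ← integral_const_mul]
    refine integral_congr_ae (Filter.Eventually.of_forall fun ω => ?_)
    simp only
    rw [← Real.exp_add]; congr 1; ring
  rw [h3]
  calc _ ≤ Real.exp (-(s * m)) * Real.exp (s * m + 192 * v ^ 2 * s ^ 2) := by
        gcongr
        refine h1.trans ?_
        have := Real.add_one_le_exp (s * m + 192 * v ^ 2 * s ^ 2)
        linarith
    _ = _ := by rw [← Real.exp_add]; congr 1; ring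

/-- Bernstein's inequality for sums of independent products of sub-Gaussian variables. -/
theorem measureReal_abs_sum_mul_sub_integral_ge_le [IsProbabilityMeasure P] {n : ℕ}
    {a b : Fin n → Ω → ℝ} {v : ℝ≥0} (hv : 0 < v) (ha : ∀ l, Measurable (a l))
    (hb : ∀ l, Measurable (b l)) (hsa : ∀ l, HasSubgaussianMGF (a l) v P)
    (hsb : ∀ l, HasSubgaussianMGF (b l) v P) (hind : iIndepFun (fun l ω => a l ω * b l ω) P)
    {s : ℝ} (hs0 : 0 ≤ s) (hs : s ≤ 1 / (8 * v)) (t : ℝ) :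
    P.real {ω | t ≤ |∑ l, (a l ω * b l ω - ∫ ω, a l ω * b l ω ∂P)|} ≤
      2 * Real.exp (-s * t + 192 * n * v ^ 2 * s ^ 2) := by
  set Y : Fin n → Ω → ℝ := fun l ω => a l ω * b l ω - ∫ ω, a l ω * b l ω ∂P with hY
  have hYm : ∀ l, Measurable (Y l) := fun l => ((ha l).mul (hb l)).sub_const _
  have hYind : iIndepFun Y P :=
    hind.comp (fun l x => x - ∫ ω, a l ω * b l ω ∂P) fun l => measurable_id.sub_const _
  have hint : ∀ r : ℝ, |r| ≤ 1 / (8 * v) → ∀ l, Integrable (fun ω => Real.exp (r * Y l ω)) P := by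
    intro r hr l
    refine ((integrable_exp_mul_mul hv (ha l) (hb l) (hsa l) (hsb l) hr).const_mul
      (Real.exp (-(r * ∫ ω, a l ω * b l ω ∂P)))).congr (Filter.Eventually.of_forall fun ω => ?_)
    simp only [hY]
    rw [← Real.exp_add]; congr 1; ring
  have hsum : ∀ r : ℝ, |r| ≤ 1 / (8 * v) →
      Integrable (fun ω => Real.exp (r * (∑ l, Y l) ω)) P ∧
        mgf (∑ l, Y l) P r ≤ Real.exp (192 * n * v ^ 2 * r ^ 2) := by
    intro r hr
    refine ⟨hYind.integrable_exp_mul_sum hYm fun l _ => hint r hr l, ?_⟩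
    rw [hYind.mgf_sum hYm]
    calc _ ≤ ∏ _l : Fin n, Real.exp (192 * v ^ 2 * r ^ 2) :=
          Finset.prod_le_prod (fun l _ => mgf_nonneg) fun l _ =>
            mgf_mul_sub_integral_le hv (ha l) (hb l) (hsa l) (hsb l) hr
      _ = _ := by
          rw [Finset.prod_const, Finset.card_univ, Fintype.card_fin, ← Real.exp_nat_mul]
          congr 1; ring
  have hsabs : |s| ≤ 1 / (8 * v) := by rwa [abs_of_nonneg hs0]
  have h1 := hsum s hsabs
  have h2 := hsum (-s) (by rwa [abs_neg])
  have hup : P.real {ω | t ≤ (∑ l, Y l) ω} ≤ Real.exp (-s * t + 192 * n * v ^ 2 * s ^ 2) := by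
    refine (measure_ge_le_exp_mul_mgf t hs0 h1.1).trans ?_
    rw [Real.exp_add]; gcongr; exact h1.2
  have hlo : P.real {ω | (∑ l, Y l) ω ≤ -t} ≤ Real.exp (-s * t + 192 * n * v ^ 2 * s ^ 2) := by
    refine (measure_le_le_exp_mul_mgf (-t) (neg_nonpos.2 hs0) h2.1).trans ?_
    rw [Real.exp_add, neg_mul_neg, neg_mul]
    gcongr
    simpa using h2.2
  have hsub : {ω | t ≤ |∑ l, Y l ω|} ⊆ {ω | t ≤ (∑ l, Y l) ω} ∪ {ω | (∑ l, Y l) ω ≤ -t} := by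
    intro ω hω
    simp only [Set.mem_union, Set.mem_ofPred_eq, Finset.sum_apply] at hω ⊢
    rcases le_abs.1 hω with h | h
    · exact Or.inl h
    · exact Or.inr (by linarith)
  calc _ ≤ _ := measureReal_mono hsub
    _ ≤ _ := measureReal_union_le _ _
    _ ≤ _ := by linarith

theorem measureReal_abs_ge_le_of_hasSubgaussianMGF [IsFiniteMeasure P] {a : Ω → ℝ} {v : ℝ≥0}
    (h : HasSubgaussianMGF a v P) {t : ℝ} (ht : 0 ≤ t) :
    P.real {ω | t ≤ |a ω|} ≤ 2 * Real.exp (-t ^ 2 / (2 * v)) := by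
  have hsub : {ω | t ≤ |a ω|} ⊆ {ω | t ≤ a ω} ∪ {ω | t ≤ (-a) ω} := by
    intro ω hω
    exact le_abs.1 (show t ≤ |a ω| from hω)
  calc _ ≤ _ := measureReal_mono hsub
    _ ≤ _ := measureReal_union_le _ _
    _ ≤ _ := add_le_add (h.measure_ge_le ht) (h.neg.measure_ge_le ht)
    _ = _ := by ring

end SubGaussianProducts

/-! ### The good event and the reduction to entrywise bounds. -/

section Assembly

variable {Ω : Type*} [MeasurableSpace Ω] {P : Measure Ω} {n p : ℕ}
  {X : Ω → Matrix (Fin n) (Fin p) ℝ} {A : Matrix (Fin p) (Fin p) ℝ} {v : ℝ≥0}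

theorem IsSubGaussianMatrix.measurable_entry (hX : IsSubGaussianMatrix P X A v) (i : Fin n)
    (a : Fin p) : Measurable fun ω => X ω i a :=
  (measurable_pi_apply a).comp (hX.measurable_row i)

theorem IsSubGaussianMatrix.hasSubgaussianMGF_entry (hX : IsSubGaussianMatrix P X A v) (i : Fin n)
    (a : Fin p) : HasSubgaussianMGF (fun ω => X ω i a) v P := by
  have h := hX.subgaussian i (EuclideanSpace.single a 1) (by simp)
  simpa [Pi.single_apply] using h

theorem IsSubGaussianMatrix.integral_mul_eq [IsProbabilityMeasure P]
    (hX : IsSubGaussianMatrix P X A v) (i : Fin n) (a b : Fin p) :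
    ∫ ω, X ω i a * X ω i b ∂P = A a b := by
  have h := hX.covariance_eq i a b
  rw [covariance_eq_sub (by simpa using (hX.hasSubgaussianMGF_entry i a).memLp 2)
    (by simpa using (hX.hasSubgaussianMGF_entry i b).memLp 2), hX.mean_zero, zero_mul,
    sub_zero] at h
  exact h

/-- Outside an event controlled by a union bound, the entries of the data and of the centred
Gram matrix are small. -/
theorem IsSubGaussianMatrix.measureReal_bad_le [IsProbabilityMeasure P]
    (hX : IsSubGaussianMatrix P X A v) (hv : 0 < v) {r t s : ℝ} (hr : 0 ≤ r)
    (hs0 : 0 ≤ s) (hs : s ≤ 1 / (8 * v)) :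
    P.real ((⋃ (i : Fin n) (a : Fin p), {ω | r ≤ |X ω i a|}) ∪
      ⋃ (a : Fin p) (b : Fin p), {ω | t ≤ |∑ i, X ω i a * X ω i b - n * A a b|}) ≤
      n * p * (2 * Real.exp (-r ^ 2 / (2 * v))) +
        p * p * (2 * Real.exp (-s * t + 192 * n * v ^ 2 * s ^ 2)) := by
  have h1 : ∀ i a, P.real {ω | r ≤ |X ω i a|} ≤ 2 * Real.exp (-r ^ 2 / (2 * v)) := fun i a =>
    measureReal_abs_ge_le_of_hasSubgaussianMGF (hX.hasSubgaussianMGF_entry i a) hr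
  have h2 : ∀ a b, P.real {ω | t ≤ |∑ i, X ω i a * X ω i b - n * A a b|} ≤
      2 * Real.exp (-s * t + 192 * n * v ^ 2 * s ^ 2) := by
    intro a b
    have h := measureReal_abs_sum_mul_sub_integral_ge_le hv (fun i => hX.measurable_entry i a)
      (fun i => hX.measurable_entry i b) (fun i => hX.hasSubgaussianMGF_entry i a)
      (fun i => hX.hasSubgaussianMGF_entry i b)
      (hX.indep_row.comp (fun _ x => x a * x b) fun _ =>
        (measurable_pi_apply a).mul (measurable_pi_apply b)) hs0 hs t
    simpa [hX.integral_mul_eq] using h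
  have union : ∀ {m q : ℕ} (S : Fin m → Fin q → Set Ω) (B : ℝ), (∀ i j, P.real (S i j) ≤ B) →
      P.real (⋃ (i) (j), S i j) ≤ m * q * B := by
    intro m q S B hS
    calc P.real (⋃ (i) (j), S i j) ≤ ∑ i, P.real (⋃ j, S i j) := measureReal_iUnion_fintype_le _
      _ ≤ ∑ i, ∑ j, P.real (S i j) := Finset.sum_le_sum fun i _ => measureReal_iUnion_fintype_le _
      _ ≤ ∑ _i : Fin m, ∑ _j : Fin q, B :=
          Finset.sum_le_sum fun i _ => Finset.sum_le_sum fun j _ => hS i j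
      _ = m * q * B := by simp [mul_assoc]
  exact (measureReal_union_le _ _).trans (add_le_add (union _ _ h1) (union _ _ h2))

/-- Both hypotheses on `r`, `s`, `t` make each bad event have probability at most `2 p⁻⁷`. There are
at most `2 p²` of them since `n ≤ p`, and `4 p⁻⁵ < p⁻²` as soon as `p ≥ 2`. -/
theorem exists_event_entries_and_gram_small [IsProbabilityMeasure P]
    (hX : IsSubGaussianMatrix P X A v) (hv : 0 < v) {r t s : ℝ} (hr : 0 ≤ r)
    (hs0 : 0 ≤ s) (hs : s ≤ 1 / (8 * v)) (hp : 2 ≤ p) (hnp : n ≤ p)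
    (hrv : 14 * v * Real.log p ≤ r ^ 2)
    (hst : 7 * Real.log p ≤ s * t - 192 * n * v ^ 2 * s ^ 2) :
    ∃ E : Set Ω, MeasurableSet E ∧ 1 - 1 / (p : ℝ) ^ 2 < P.real E ∧ ∀ ω ∈ E,
      (∀ i a, |X ω i a| ≤ r) ∧ ∀ a b, |∑ i, X ω i a * X ω i b - n * A a b| ≤ t := by
  set B := (⋃ (i : Fin n) (a : Fin p), {ω | r ≤ |X ω i a|}) ∪
    ⋃ (a : Fin p) (b : Fin p), {ω | t ≤ |∑ i, X ω i a * X ω i b - n * A a b|} with hB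
  have hBm : MeasurableSet B := by
    refine (MeasurableSet.iUnion fun i => MeasurableSet.iUnion fun a => ?_).union
      (MeasurableSet.iUnion fun a => MeasurableSet.iUnion fun b => ?_)
    · have := hX.measurable_entry i a
      exact measurableSet_le measurable_const (by fun_prop)
    · have h1 := fun i => hX.measurable_entry i a
      have h2 := fun i => hX.measurable_entry i b
      refine measurableSet_le measurable_const ?_
      exact ((Finset.measurable_fun_sum _ fun i _ => (h1 i).mul (h2 i)).sub_const _).abs
  refine ⟨Bᶜ, hBm.compl, ?_, ?_⟩
  · have hv' : (0 : ℝ) < v := hv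
    have hp2 : (2 : ℝ) ≤ p := by exact_mod_cast hp
    have hp0 : (0 : ℝ) < p := by linarith
    have hnp' : (n : ℝ) ≤ p := by exact_mod_cast hnp
    have hexp : Real.exp (-(7 * Real.log p)) = 1 / (p : ℝ) ^ 7 := by
      rw [Real.exp_neg, show (7 : ℝ) * Real.log p = ((7 : ℕ) : ℝ) * Real.log p by norm_num,
        Real.exp_nat_mul, Real.exp_log hp0, one_div]
    have h1 : Real.exp (-r ^ 2 / (2 * v)) ≤ 1 / (p : ℝ) ^ 7 := by
      rw [← hexp, Real.exp_le_exp, div_le_iff₀ (by positivity)]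
      linarith
    have h2 : Real.exp (-s * t + 192 * n * v ^ 2 * s ^ 2) ≤ 1 / (p : ℝ) ^ 7 := by
      rw [← hexp, Real.exp_le_exp]
      linarith
    have h3 : P.real B ≤ p * p * (2 * (1 / (p : ℝ) ^ 7)) + p * p * (2 * (1 / (p : ℝ) ^ 7)) :=
      (hX.measureReal_bad_le hv hr hs0 hs).trans (by gcongr)
    have h4 : p * p * (2 * (1 / (p : ℝ) ^ 7)) + p * p * (2 * (1 / (p : ℝ) ^ 7)) <
        1 / (p : ℝ) ^ 2 := by
      have h5 : (2 : ℝ) ^ 3 ≤ p ^ 3 := by gcongr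
      have h6 : p * p * (2 * (1 / (p : ℝ) ^ 7)) + p * p * (2 * (1 / (p : ℝ) ^ 7)) =
          4 / (p : ℝ) ^ 3 * (1 / (p : ℝ) ^ 2) := by field_simp; ring
      rw [h6]
      refine mul_lt_of_lt_one_left (by positivity) ?_
      rw [div_lt_one (by positivity)]
      linarith
    rw [probReal_compl_eq_one_sub hBm]
    linarith
  · intro ω hω
    simp only [hB, Set.mem_compl_iff, Set.mem_union, Set.mem_iUnion, Set.mem_ofPred_eq, not_or,
      not_exists, not_le] at hω
    exact ⟨fun i a => (hω.1 i a).le, fun a b => (hω.2 a b).le⟩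

theorem dotProduct_renGamma_mulVec {N : ℕ} (α : ℝ) (no : ℕ) (Z : Matrix (Fin N) (Fin p) ℝ)
    (S : Matrix (Fin p) (Fin p) ℝ) (θ : Fin p → ℝ) :
    θ ⬝ᵥ (renGamma α no Z *ᵥ θ) = α * (θ ⬝ᵥ (S *ᵥ θ)) +
      α * (θ ⬝ᵥ ((Matrix.of fun i j =>
        trimmedInner no (fun k => Z k i) (fun k => Z k j) - S i j) *ᵥ θ)) +
      (1 - α) * ‖WithLp.toLp 2 θ‖ ^ 2 := by
  have h : renGamma α no Z = α • S + α • (Matrix.of fun i j =>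
      trimmedInner no (fun k => Z k i) (fun k => Z k j) - S i j) + (1 - α) • 1 := by
    ext i j
    simp [renGamma]
    ring
  have hn : ‖WithLp.toLp 2 θ‖ ^ 2 = θ ⬝ᵥ θ := by
    rw [EuclideanSpace.real_norm_sq_eq]
    simp [dotProduct, sq]
  rw [h, hn]
  simp only [Matrix.add_mulVec, Matrix.smul_mulVec, dotProduct_add, dotProduct_smul, smul_eq_mul,
    Matrix.one_mulVec]

/-- An entrywise bound on the trimmed Gram matrix gives both restricted eigenvalue conditions. -/
theorem lowerRE_and_upperRE_renGamma [NeZero p] {N no : ℕ} {S : Matrix (Fin p) (Fin p) ℝ}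
    (hS : S.PosDef) {α : ℝ} (hα : α ∈ Set.Icc (0 : ℝ) 1) (Z : Matrix (Fin N) (Fin p) ℝ)
    (hZ : ∀ i j, |trimmedInner no (fun k => Z k i) (fun k => Z k j) - S i j| ≤
      lambdaMin hS.isHermitian / 8) :
    LowerRE (renGamma α no Z) (α * (lambdaMin hS.isHermitian / 2) + (1 - α))
        (α / 8 * lambdaMin hS.isHermitian) ∧
      UpperRE (renGamma α no Z) (α * (3 * lambdaMax hS.isHermitian / 2) + (1 - α))
        (α / 8 * lambdaMin hS.isHermitian) := by
  obtain ⟨hα0, hα1⟩ := hα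
  have hmin := lambdaMin_pos hS
  have hmax := hmin.trans_le (lambdaMin_le_lambdaMax hS.isHermitian)
  have hpos : ∀ x : ℝ, 0 < x → 0 < α * x + (1 - α) := by
    intro x hx
    rcases hα0.eq_or_lt with rfl | h
    · norm_num
    · have := mul_pos h hx
      linarith
  have hτ : 0 ≤ α / 8 * lambdaMin hS.isHermitian := by positivity
  refine ⟨⟨hpos _ (by linarith), hτ, fun θ => ?_⟩, ⟨hpos _ (by linarith), hτ, fun θ => ?_⟩⟩
  all_goals
    rw [dotProduct_renGamma_mulVec α no Z S θ]
    have h1 := abs_le.1 (abs_dotProduct_mulVec_le (Matrix.of fun i j =>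
      trimmedInner no (fun k => Z k i) (fun k => Z k j) - S i j) hZ θ)
    have h2 := sq_nonneg ‖WithLp.toLp 2 θ‖
  · have h3 := lambdaMin_mul_norm_sq_le hS.isHermitian θ
    have h4 := mul_le_mul_of_nonneg_left h1.1 hα0
    have h5 := mul_le_mul_of_nonneg_left h3 hα0
    have h6 : 0 ≤ α * (lambdaMin hS.isHermitian * ‖WithLp.toLp 2 θ‖ ^ 2) := by positivity
    linarith
  · have h3 := le_lambdaMax_mul_norm_sq hS.isHermitian θ
    have h4 := mul_le_mul_of_nonneg_left h1.2 hα0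
    have h5 := mul_le_mul_of_nonneg_left h3 hα0
    have h6 : 0 ≤ α * (lambdaMax hS.isHermitian * ‖WithLp.toLp 2 θ‖ ^ 2) := by positivity
    linarith

end Assembly

/-! ### Choice of the constants and conclusion. -/

theorem lemma1 :
    ∃ C c : ℝ, 0 < C ∧ 0 < c ∧
      ∀ (Ω : Type*) [MeasurableSpace Ω] (P : Measure Ω) [IsProbabilityMeasure P]
        (n p k no : ℕ) (_hn : 0 < n) (_hnp : n ≤ p) (_hk : 1 ≤ k) (_hkp : k < p)
        (Sx : Matrix (Fin p) (Fin p) ℝ) (hSx : Sx.PosDef)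
        (σ : ℝ≥0) (_hσ : 0 < σ)
        (X : Ω → Matrix (Fin n) (Fin p) ℝ)
        (_hX : IsSubGaussianMatrix P X ((1 / (n : ℝ)) • Sx) (σ ^ 2 / n))
        (_hcond1 : (n : ℝ) ≥
          C * ((σ : ℝ) ^ 4 / lambdaMin hSx.isHermitian ^ 2 * k * Real.log p))
        (_hcond2 : (no : ℝ) / n ≤
          c * (lambdaMin hSx.isHermitian / ((σ : ℝ) ^ 2 * k * Real.log p)))
        (α : ℝ) (_hα : α ∈ Set.Icc (0 : ℝ) 1),
        ∃ τ : ℝ, τ ≤ α / 8 * lambdaMin hSx.isHermitian ∧ (0 < α → 0 < τ) ∧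
          ∃ E : Set Ω, MeasurableSet E ∧ 1 - 1 / (p : ℝ) ^ 2 < P.real E ∧
            ∀ ω ∈ E, ∀ Z : Matrix (Fin (n + no)) (Fin p) ℝ, IsCorruption no (X ω) Z →
              LowerRE (renGamma α no Z)
                (α * (lambdaMin hSx.isHermitian / 2) + (1 - α)) τ ∧
              UpperRE (renGamma α no Z)
                (α * (3 * lambdaMax hSx.isHermitian / 2) + (1 - α)) τ := by
  -- `C` makes the optimised Bernstein exponent reach `7 log p`. In `c`, `448 = 28 * 16`: the
  -- trimming error is `28 (no / n) σ² log p` and must fit in `l / 16`.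
  refine ⟨32 * 6144 * 7, 1 / 448, by norm_num, by norm_num, ?_⟩
  intro Ω _ P _ n p k no hn hnp hk hkp Sx hSx σ hσ X hX hc1 hc2 α hα
  have : NeZero p := ⟨by omega⟩
  set l := lambdaMin hSx.isHermitian with hl
  have hl0 : 0 < l := lambdaMin_pos hSx
  have hσ' : (0 : ℝ) < σ := hσ
  have hn' : (0 : ℝ) < n := by exact_mod_cast hn
  have hk' : (1 : ℝ) ≤ k := by exact_mod_cast hk
  have hp : 2 ≤ p := by omega
  have hL : 0 < Real.log p := Real.log_pos (by exact_mod_cast hp)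
  have hkL : Real.log p ≤ k * Real.log p := le_mul_of_one_le_left hL.le hk'
  have hv : 0 < σ ^ 2 / (n : ℝ≥0) := by positivity
  have hvr : ((σ ^ 2 / (n : ℝ≥0) : ℝ≥0) : ℝ) = (σ : ℝ) ^ 2 / n := by push_cast; rfl
  -- This makes the Bernstein parameter `s` below admissible, that is, at most `n / (8 σ²)`.
  have hl2 : l ≤ 2 * (σ : ℝ) ^ 2 := by
    have h1 := integral_sq_le_of_hasSubgaussianMGF hv (hX.measurable_entry ⟨0, hn⟩ 0)
      (hX.hasSubgaussianMGF_entry ⟨0, hn⟩ 0)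
    have h2 := hX.integral_mul_eq ⟨0, hn⟩ 0 0
    simp only [← sq, Matrix.smul_apply, smul_eq_mul] at h2
    have h3 := lambdaMin_le_diag hSx.isHermitian 0
    rw [h2, hvr, one_div, inv_mul_le_iff₀ hn'] at h1
    calc l ≤ Sx 0 0 := h3
      _ ≤ _ := h1
      _ = _ := by field_simp
  have hn1 : 32 * 6144 * 7 * ((σ : ℝ) ^ 4 / l ^ 2 * Real.log p) ≤ n := by
    refine le_trans ?_ hc1
    rw [mul_assoc ((σ : ℝ) ^ 4 / l ^ 2)]
    gcongr
  have hn2 : (no : ℝ) / n * ((σ : ℝ) ^ 2 * Real.log p) ≤ 1 / 448 * l := by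
    calc _ ≤ (no : ℝ) / n * ((σ : ℝ) ^ 2 * (k * Real.log p)) := by gcongr
      _ ≤ 1 / 448 * (l / ((σ : ℝ) ^ 2 * k * Real.log p)) *
          ((σ : ℝ) ^ 2 * (k * Real.log p)) := by gcongr
      _ = _ := by field_simp
  obtain ⟨E, hEm, hE, hω⟩ := exists_event_entries_and_gram_small hX hv
    (r := √(14 * ((σ : ℝ) ^ 2 / n) * Real.log p)) (t := l / 16)
    -- The maximiser `t / (384 n v²)` of `s t - 192 n v² s²` for `v = σ² / n` and `t = l / 16`; the
    -- maximum is `s t / 2`.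
    (s := l * n / (6144 * (σ : ℝ) ^ 4)) (Real.sqrt_nonneg _) (by positivity)
    (by
      rw [hvr, div_le_div_iff₀ (by positivity) (by positivity)]
      have : l * n * (8 * ((σ : ℝ) ^ 2 / n)) = 8 * (l * (σ : ℝ) ^ 2) := by field_simp
      rw [this]
      have h2 := mul_le_mul_of_nonneg_right hl2 (sq_nonneg (σ : ℝ))
      nlinarith [pow_pos hσ' 4])
    hp hnp
    (by rw [hvr, Real.sq_sqrt (by positivity)])
    (by
      have h1 : l * n / (6144 * (σ : ℝ) ^ 4) * (l / 16) - 192 * n *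
          ((σ ^ 2 / (n : ℝ≥0) : ℝ≥0) : ℝ) ^ 2 * (l * n / (6144 * (σ : ℝ) ^ 4)) ^ 2 =
          l ^ 2 / (32 * 6144 * (σ : ℝ) ^ 4) * n := by
        rw [hvr]; field_simp; norm_num
      rw [h1]
      calc 7 * Real.log p = l ^ 2 / (32 * 6144 * (σ : ℝ) ^ 4) *
            (32 * 6144 * 7 * ((σ : ℝ) ^ 4 / l ^ 2 * Real.log p)) := by field_simp
        _ ≤ _ := by gcongr)
  refine ⟨α / 8 * l, le_rfl, fun h => by positivity, E, hEm, hE, ?_⟩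
  rintro ω hωE Z ⟨e, he⟩
  obtain ⟨hr, hG⟩ := hω ω hωE
  refine lowerRE_and_upperRE_renGamma hSx hα Z fun i j => ?_
  set M := 14 * ((σ : ℝ) ^ 2 / n) * Real.log p with hM
  have hM0 : 0 ≤ M := by positivity
  have h1 := abs_trimmedInner_sub_le (fun k => Z k i) (fun k => Z k j) e hM0 (by
    intro q
    simp only [he]
    rw [abs_mul, ← Real.mul_self_sqrt hM0]
    exact mul_le_mul (hr q i) (hr q j) (abs_nonneg _) (Real.sqrt_nonneg _))
  have h2 := hG i j
  simp only [he] at h1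
  have h3 : (n : ℝ) * ((1 / (n : ℝ)) • Sx) i j = Sx i j := by
    simp only [Matrix.smul_apply, smul_eq_mul]; field_simp
  rw [h3] at h2
  -- The trimming half of the error budget; `h2` is the other half.
  have h4 : 2 * no * M ≤ l / 16 := by
    have : 2 * no * M = 28 * ((no : ℝ) / n * ((σ : ℝ) ^ 2 * Real.log p)) := by
      rw [hM]; ring
    linarith
  have h5 := abs_sub_le (trimmedInner no (fun k => Z k i) fun k => Z k j)
    (∑ q, X ω q i * X ω q j) (Sx i j)
  linarith
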